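/- For every $n\in\mathbb{N}$ let $\sigma=\sigma_n$ be a uniformly distributed random permutation of $\{1,\dots,n\}$, and let \[C_n=\frac1n\sum_{k=1}^n \sigma(k)\,e^{2\pi i k/n},\qquad X_n=\frac{1}{\sqrt n}\operatorname{Re}C_n,\qquad Y_n=\frac{1}{\sqrt n}\operatorname{Im}C_n .\] Then, as $n\to\infty$, the distribution of $(X_n,Y_n)^T$ converges weakly to the two-dimensional Gaussian distribution with mean $(0,0)^T$ and covariance matrix \[\Gamma=\begin{pmatrix}\frac1{24}&0\\0&\frac1{24}\end{pmatrix}.\] In particular, $Z_n=\frac1{\sqrt n}C_n$ converges weakly, as $n\to\infty$, to a circularly-symmetric central complex normal distribution with variance $\frac1{12}$, that is, to a Gaussian law $\nu$ on $\mathbb{C}\cong\mathbb{R}^2$ with mean $0$ that is invariant under all rotations $z\mapsto e^{i\theta}z$ and satisfies $\int|z|^2\,d\nu(z)=\frac1{12}$. -/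

import Mathlib

open MeasureTheory ProbabilityTheory Filter

/-- The centroid `C_n(σ) = (1/n) ∑_{k=1}^n σ(k) e^{2πik/n}`. The set `{1, …, n}` is represented by
`Fin n = {0, …, n-1}`, shifted by one, both for the index `k` and for the value `σ(k)`. -/
noncomputable def permCentroid (n : ℕ) (σ : Equiv.Perm (Fin n)) : ℂ :=
  (1 / (n : ℂ)) * ∑ k : Fin n, (((σ k : ℕ) : ℂ) + 1) *
    Complex.exp (2 * (Real.pi : ℂ) * Complex.I * (((k : ℕ) : ℂ) + 1) / (n : ℂ))

/-- `σ` is a random variable with values in the (finite, discrete) symmetric group `S_n` which is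
uniformly distributed: each permutation is taken with probability `1 / n!`. -/
def IsUniformPerm {Ω : Type*} [MeasurableSpace Ω] (P : Measure Ω) (n : ℕ)
    (σ : Ω → Equiv.Perm (Fin n)) : Prop :=
  ∀ τ : Equiv.Perm (Fin n),
    MeasurableSet (σ ⁻¹' {τ}) ∧ P (σ ⁻¹' {τ}) = ((n.factorial : ℕ) : ENNReal)⁻¹

/-- `ν` is a circularly-symmetric central complex normal law with variance `v`: it is Gaussian on
`ℂ` (as a real vector space), has mean zero, is invariant under all rotations
`z ↦ e^{iθ} z`, and satisfies `∫ |z|² dν = v`. -/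
structure IsCircularComplexNormal (ν : Measure ℂ) (v : ℝ) : Prop where
  isGaussian : IsGaussian ν
  mean_eq_zero : ∫ z, z ∂ν = 0
  map_rotation : ∀ θ : ℝ, ν.map (fun z => Complex.exp ((θ : ℂ) * Complex.I) * z) = ν
  variance_eq : ∫ z, ‖z‖ ^ 2 ∂ν = v

/-!
By the Cramér–Wold idea it suffices to treat one real projection `Re (w C_n) / √n`. As the roots of
unity sum to zero, the values of `σ` may be centred, and the projection is a linear permutation
statistic `S σ = ∑ k, a (σ k) * c k` with `∑ a = ∑ c = 0`, divided by `√n` (`re_mul_permCentroid`).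

The central limit theorem for such statistics is proved with exchangeable pairs. Composing `σ` with
the transposition of `i` and `j` lowers `S` by `D i j = (a (σ i) - a (σ j)) * (c i - c j)`, and
`∑ i, ∑ j, D i j = 2 n S`. The map `σ ↦ σ * swap i j` preserves the uniform law and changes the sign
of `D i j`, so that for every function `F`
`4 n ∑ σ, S σ • F σ = ∑ σ, ∑ i, ∑ j, D i j • (F σ - F (σ * swap i j))` (`sum_permSum_smul`).
For `F = S` this bounds the second moment of `S`. For `F = exp (i u S)` a first-order expansion
leaves `i u (∑ i, ∑ j, D i j ^ 2) F`, where
`∑ i, ∑ j, D i j ^ 2 = 4 (∑ a²) (∑ c²) + 2 n S' + 4 S²`, with `S'` the linear permutation statistic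
of the centred `a²` and of `c²`; the second moment bound applies to `S'` as well, so both extra
terms are negligible. Hence the characteristic function `φ` of `S / √n` satisfies
`φ' t = -v t φ t + O(1 / √n)` on `[0, 1]` with `v = (∑ a²) (∑ c²) / n²`, and multiplying by
`exp (v t² / 2)` gives `φ 1 = exp (-v / 2) + O(1 / √n)` (`norm_mean_cexp_permSum_sub_le`).

Here `∑ a² = (n² - 1) / (12 n)` and `∑ c² = n ‖w‖² / 2`, so `v` tends to `‖w‖² / 24`. Lévy's
continuity theorem gives the convergence in the plane. The complex statement is its image under the
isometry `(x, y) ↦ x + i y`; the limit is invariant under rotations because its characteristic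
function depends on the norm only.
-/

open scoped Topology ComplexConjugate RealInnerProductSpace

/-! ### Linear permutation statistics and transpositions -/

section PermSum

variable {ι : Type*} [Fintype ι]

/-- The linear permutation statistic `∑ k, a (σ k) * c k`. -/
def permSum (a c : ι → ℝ) (σ : Equiv.Perm ι) : ℝ := ∑ k, a (σ k) * c k

/-- The amount by which `permSum a c` drops when `σ` is replaced by `σ * swap i j`. -/
def swapDrop {ι : Type*} (a c : ι → ℝ) (σ : Equiv.Perm ι) (i j : ι) : ℝ :=
  (a (σ i) - a (σ j)) * (c i - c j)

lemma swapDrop_mul_swap {ι : Type*} [DecidableEq ι] (a c : ι → ℝ) (σ : Equiv.Perm ι) (i j : ι) :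
    swapDrop a c (σ * Equiv.swap i j) i j = - swapDrop a c σ i j := by
  simp [swapDrop]; ring

lemma permSum_mul_swap [DecidableEq ι] (a c : ι → ℝ) (σ : Equiv.Perm ι) (i j : ι) :
    permSum a c (σ * Equiv.swap i j) = permSum a c σ - swapDrop a c σ i j := by
  have h : permSum a c σ - permSum a c (σ * Equiv.swap i j)
      = ∑ k, (a (σ k) - a (σ (Equiv.swap i j k))) * c k := by
    simp only [permSum, ← Finset.sum_sub_distrib, Equiv.Perm.mul_apply, sub_mul]
  rw [eq_sub_iff_add_eq, ← eq_sub_iff_add_eq', h]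
  rcases eq_or_ne i j with rfl | hij
  · simp [swapDrop]
  rw [← Finset.sum_subset (Finset.subset_univ {i, j}), Finset.sum_pair hij]
  · simp [swapDrop]; ring
  · intro k _ hk
    simp only [Finset.mem_insert, Finset.mem_singleton, not_or] at hk
    simp [Equiv.swap_apply_of_ne_of_ne hk.1 hk.2]

lemma sum_comp_perm (f : ι → ℝ) (σ : Equiv.Perm ι) : ∑ k, f (σ k) = ∑ k, f k :=
  Equiv.sum_comp σ f

lemma sum_sum_swapDrop {a c : ι → ℝ} (ha : ∑ k, a k = 0) (σ : Equiv.Perm ι) :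
    ∑ i, ∑ j, swapDrop a c σ i j = 2 * Fintype.card ι * permSum a c σ := by
  have h1 : ∀ i, ∑ j, swapDrop a c σ i j
      = Fintype.card ι * (a (σ i) * c i) - a (σ i) * ∑ j, c j + permSum a c σ := by
    intro i
    have e : ∀ j, swapDrop a c σ i j
        = a (σ i) * c i - a (σ i) * c j - a (σ j) * c i + a (σ j) * c j := by
      intro j; simp only [swapDrop]; ring
    simp only [e, Finset.sum_add_distrib, Finset.sum_sub_distrib, ← Finset.mul_sum,
      ← Finset.sum_mul, sum_comp_perm, ha, permSum]
    simp
    ring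
  simp only [h1, Finset.sum_add_distrib, Finset.sum_sub_distrib, ← Finset.mul_sum,
      ← Finset.sum_mul, sum_comp_perm, ha, permSum]
  simp
  ring

lemma sum_sum_swapDrop_sq {a c : ι → ℝ} (ha : ∑ k, a k = 0) (hc : ∑ k, c k = 0)
    (σ : Equiv.Perm ι) :
    ∑ i, ∑ j, swapDrop a c σ i j ^ 2 =
      2 * Fintype.card ι * permSum (fun k ↦ a k ^ 2) (fun k ↦ c k ^ 2) σ
        + 2 * (∑ k, a k ^ 2) * (∑ k, c k ^ 2) + 4 * permSum a c σ ^ 2 := by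
  have h1 : ∀ i, ∑ j, swapDrop a c σ i j ^ 2
      = Fintype.card ι * (a (σ i) ^ 2 * c i ^ 2) + a (σ i) ^ 2 * (∑ j, c j ^ 2)
        + c i ^ 2 * (∑ j, a j ^ 2) + (∑ k, a (σ k) ^ 2 * c k ^ 2)
        + 4 * (a (σ i) * c i) * permSum a c σ
        - 2 * c i * (∑ k, a (σ k) ^ 2 * c k) - 2 * a (σ i) * (∑ k, a (σ k) * c k ^ 2) := by
    intro i
    have e : ∀ j, swapDrop a c σ i j ^ 2
        = a (σ i) ^ 2 * c i ^ 2 + a (σ i) ^ 2 * c j ^ 2 + c i ^ 2 * a (σ j) ^ 2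
          + a (σ j) ^ 2 * c j ^ 2 + 4 * (a (σ i) * c i) * (a (σ j) * c j)
          - 2 * c i * (a (σ j) ^ 2 * c j) - 2 * a (σ i) * (a (σ j) * c j ^ 2)
          - 2 * a (σ i) ^ 2 * c i * c j - 2 * a (σ i) * c i ^ 2 * a (σ j) := by
      intro j; simp only [swapDrop]; ring
    simp only [e, Finset.sum_add_distrib, Finset.sum_sub_distrib, ← Finset.mul_sum,
      sum_comp_perm (fun k ↦ a k ^ 2), sum_comp_perm a, ha, hc, permSum]
    simp
    ring
  simp only [h1, Finset.sum_add_distrib, Finset.sum_sub_distrib, ← Finset.mul_sum,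
      ← Finset.sum_mul, sum_comp_perm (fun k ↦ a k ^ 2), sum_comp_perm a, ha, hc, permSum]
  simp
  ring

lemma permSum_sub_const (a c : ι → ℝ) (m : ℝ) (σ : Equiv.Perm ι) :
    permSum (fun k ↦ a k - m) c σ = permSum a c σ - m * ∑ k, c k := by
  simp [permSum, sub_mul, Finset.sum_sub_distrib, Finset.mul_sum]

variable [DecidableEq ι]

/-- Antisymmetrization under the bijection `σ ↦ σ * swap i j`, which changes the sign of the drop.
-/
lemma two_smul_sum_swapDrop_smul {E : Type*} [AddCommGroup E] [Module ℝ E] (a c : ι → ℝ)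
    (i j : ι) (F : Equiv.Perm ι → E) :
    (2 : ℝ) • ∑ σ, swapDrop a c σ i j • F σ =
      ∑ σ, swapDrop a c σ i j • (F σ - F (σ * Equiv.swap i j)) := by
  have h : ∑ σ, swapDrop a c σ i j • F σ
      = ∑ σ, -(swapDrop a c σ i j • F (σ * Equiv.swap i j)) := by
    rw [← Equiv.sum_comp (Equiv.mulRight (Equiv.swap i j))]
    simp [swapDrop_mul_swap]
  simp only [smul_sub, Finset.sum_sub_distrib]
  rw [Finset.sum_neg_distrib] at h
  rw [sub_eq_add_neg, ← h, two_smul]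

/-- Stein identity for the exchangeable pair `(σ, σ * swap i j)` with `i`, `j` uniform. The
expected drop of `permSum` is proportional to `permSum` itself, so testing against `F` turns
`permSum * F` into drops times increments of `F`. -/
lemma sum_permSum_smul {E : Type*} [AddCommGroup E] [Module ℝ E] {a : ι → ℝ} (c : ι → ℝ)
    (ha : ∑ k, a k = 0) (F : Equiv.Perm ι → E) :
    (4 * Fintype.card ι : ℝ) • ∑ σ, permSum a c σ • F σ =
      ∑ σ, ∑ i, ∑ j, swapDrop a c σ i j • (F σ - F (σ * Equiv.swap i j)) := by
  calc (4 * Fintype.card ι : ℝ) • ∑ σ, permSum a c σ • F σ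
      = (2 : ℝ) • ∑ σ, ∑ i, ∑ j, swapDrop a c σ i j • F σ := by
        simp only [← Finset.sum_smul, sum_sum_swapDrop ha, Finset.smul_sum, smul_smul]
        refine Finset.sum_congr rfl fun σ _ ↦ ?_
        congr 1; ring
    _ = ∑ i, ∑ j, (2 : ℝ) • ∑ σ, swapDrop a c σ i j • F σ := by
        simp only [← Finset.smul_sum]
        congr 1
        rw [Finset.sum_comm]
        exact Finset.sum_congr rfl fun i _ ↦ Finset.sum_comm
    _ = _ := by
        simp only [two_smul_sum_swapDrop_smul]
        rw [Finset.sum_comm (γ := Equiv.Perm ι)]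
        exact Finset.sum_congr rfl fun i _ ↦ Finset.sum_comm

end PermSum

/-! ### Moment bounds and the approximate differential equation -/

section CharFun

variable {ι : Type*} [Fintype ι] [DecidableEq ι] [Nonempty ι] {a c : ι → ℝ} {M M' : ℝ}

/-- Second moment bound: the Stein identity with `F = permSum`. Only one of the two coefficient
vectors needs to be centred. -/
lemma sum_permSum_sq_le (ha : ∑ k, a k = 0)
    (hM : ∀ i j k l, |(a i - a j) * (c k - c l)| ≤ M) :
    ∑ σ : Equiv.Perm ι, permSum a c σ ^ 2 ≤
      Fintype.card (Equiv.Perm ι) * (Fintype.card ι * M ^ 2 / 4) := by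
  have hn : (0 : ℝ) < Fintype.card ι := by exact_mod_cast Fintype.card_pos
  have h := sum_permSum_smul c ha (permSum a c)
  simp only [smul_eq_mul, permSum_mul_swap, sub_sub_cancel, ← pow_two] at h
  have h2 : ∑ σ : Equiv.Perm ι, ∑ i, ∑ j, swapDrop a c σ i j ^ 2 ≤
      ∑ _σ : Equiv.Perm ι, ∑ _i : ι, ∑ _j : ι, M ^ 2 := by
    refine Finset.sum_le_sum fun σ _ ↦ Finset.sum_le_sum fun i _ ↦ Finset.sum_le_sum fun j _ ↦ ?_
    exact sq_le_sq.2 ((hM _ _ _ _).trans (le_abs_self M))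
  simp only [Finset.sum_const, Finset.card_univ, nsmul_eq_mul] at h2
  rw [← h] at h2
  have h3 : (4 * Fintype.card ι : ℝ) * ∑ σ : Equiv.Perm ι, permSum a c σ ^ 2 ≤
      (4 * Fintype.card ι : ℝ) *
        (Fintype.card (Equiv.Perm ι) * (Fintype.card ι * M ^ 2 / 4)) := by
    refine h2.trans_eq ?_
    ring
  exact le_of_mul_le_mul_left h3 (by positivity)

lemma sum_abs_permSum_le (ha : ∑ k, a k = 0)
    (hM : ∀ i j k l, |(a i - a j) * (c k - c l)| ≤ M) :
    ∑ σ : Equiv.Perm ι, |permSum a c σ| ≤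
      Fintype.card (Equiv.Perm ι) * (√(Fintype.card ι) * M / 2) := by
  have hM0 : 0 ≤ M :=
    (abs_nonneg _).trans (hM (Classical.arbitrary ι) (Classical.arbitrary ι)
      (Classical.arbitrary ι) (Classical.arbitrary ι))
  refine (le_abs_self _).trans (abs_le_of_sq_le_sq ?_ (by positivity))
  refine sq_sum_le_card_mul_sum_sq.trans ?_
  simp only [sq_abs, Finset.card_univ]
  refine (mul_le_mul_of_nonneg_left (sum_permSum_sq_le ha hM) (by positivity)).trans_eq ?_
  rw [mul_pow, div_pow, mul_pow, Real.sq_sqrt (by positivity)]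
  ring

lemma norm_cexp_I_mul_sub_one_sub_le (x : ℝ) :
    ‖Complex.exp (Complex.I * x) - 1 - Complex.I * x‖ ≤ 2 * x ^ 2 := by
  rcases le_or_gt |x| 1 with hx | hx
  · have h := Complex.norm_exp_sub_one_sub_id_le (x := Complex.I * x) (by simpa using hx)
    refine h.trans ?_
    simp only [norm_mul, Complex.norm_I, one_mul, Complex.norm_real, Real.norm_eq_abs, sq_abs]
    nlinarith [sq_nonneg x]
  · have h1 := Real.norm_exp_I_mul_ofReal_sub_one_le (x := x)
    have h2 : ‖Complex.I * (x : ℂ)‖ = |x| := by simp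
    refine (norm_sub_le _ _).trans ?_
    rw [h2]
    rw [Real.norm_eq_abs] at h1
    nlinarith [sq_abs x]

/-- First-order expansion of the increment of `exp (i u permSum)` across a transposition. -/
lemma norm_swapDrop_smul_sub_le {ι : Type*} [Fintype ι] [DecidableEq ι] {a c : ι → ℝ} {M : ℝ}
    (hM : ∀ i j k l, |(a i - a j) * (c k - c l)| ≤ M)
    (u : ℝ) (σ : Equiv.Perm ι) (i j : ι) :
    ‖swapDrop a c σ i j • (Complex.exp (Complex.I * (u * permSum a c σ : ℝ)) -
        Complex.exp (Complex.I * (u * permSum a c (σ * Equiv.swap i j) : ℝ)))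
      - Complex.I * u * (swapDrop a c σ i j ^ 2 : ℝ) *
        Complex.exp (Complex.I * (u * permSum a c σ : ℝ))‖ ≤ 2 * u ^ 2 * M ^ 3 := by
  have hD : |swapDrop a c σ i j| ≤ M := hM _ _ _ _
  rw [permSum_mul_swap]
  set D := swapDrop a c σ i j
  set S := permSum a c σ
  have e : D • (Complex.exp (Complex.I * (u * S : ℝ)) -
        Complex.exp (Complex.I * (u * (S - D) : ℝ)))
      - Complex.I * u * (D ^ 2 : ℝ) * Complex.exp (Complex.I * (u * S : ℝ))
      = -(D * Complex.exp (Complex.I * (u * S : ℝ)) *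
        (Complex.exp (Complex.I * (-(u * D) : ℝ)) - 1 - Complex.I * (-(u * D) : ℝ))) := by
    have : Complex.exp (Complex.I * (u * (S - D) : ℝ)) =
        Complex.exp (Complex.I * (u * S : ℝ)) * Complex.exp (Complex.I * (-(u * D) : ℝ)) := by
      rw [← Complex.exp_add]
      congr 1; push_cast; ring
    rw [this, Complex.real_smul]
    push_cast
    ring
  rw [e, norm_neg, norm_mul, norm_mul, Complex.norm_exp_I_mul_ofReal, mul_one, Complex.norm_real,
    Real.norm_eq_abs]
  calc |D| * _ ≤ |D| * (2 * (-(u * D)) ^ 2) := by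
        gcongr; exact norm_cexp_I_mul_sub_one_sub_le _
    _ = 2 * u ^ 2 * |D| ^ 3 := by
        rw [← sq_abs (-(u * D)), abs_neg, abs_mul, mul_pow, sq_abs u]
        ring
    _ ≤ _ := by gcongr

/-- The Stein identity for `F = exp (i u permSum)`, with the sum of squared drops replaced by its
leading constant `4 (∑ a²) (∑ c²)`. The fluctuation of that sum consists of the centred statistic
built from `a²` and `c²` and of `permSum²`, both controlled by second moments. -/
lemma norm_sum_permSum_mul_cexp_sub_le (ha : ∑ k, a k = 0) (hc : ∑ k, c k = 0)
    (hM : ∀ i j k l, |(a i - a j) * (c k - c l)| ≤ M)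
    (hM' : ∀ i j k l, |(a i ^ 2 - a j ^ 2) * (c k ^ 2 - c l ^ 2)| ≤ M') {u : ℝ} (hu : 0 ≤ u) :
    ‖(4 * Fintype.card ι : ℂ) *
        ∑ σ, permSum a c σ * Complex.exp (Complex.I * (u * permSum a c σ : ℝ))
      - Complex.I * u * (4 * (∑ k, a k ^ 2) * (∑ k, c k ^ 2) : ℝ) *
        ∑ σ, Complex.exp (Complex.I * (u * permSum a c σ : ℝ))‖ ≤
    Fintype.card (Equiv.Perm ι) * (u * (Fintype.card ι * √(Fintype.card ι) * M'
      + Fintype.card ι * M ^ 2) + 2 * u ^ 2 * M ^ 3 * Fintype.card ι ^ 2) := by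
  have hn : (0 : ℝ) < Fintype.card ι := by exact_mod_cast Fintype.card_pos
  set n : ℝ := ((Fintype.card ι : ℕ) : ℝ) with hndef
  set N : ℝ := ((Fintype.card (Equiv.Perm ι) : ℕ) : ℝ) with hNdef
  set A := ∑ k, a k ^ 2 with hA
  set C := ∑ k, c k ^ 2 with hC
  set e : Equiv.Perm ι → ℂ := fun σ ↦ Complex.exp (Complex.I * (u * permSum a c σ : ℝ)) with he
  have hen : ∀ σ, ‖e σ‖ = 1 := fun σ ↦ Complex.norm_exp_I_mul_ofReal _
  set Q : Equiv.Perm ι → ℝ := permSum (fun k ↦ a k ^ 2 - A / n) (fun k ↦ c k ^ 2) with hQ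
  have h1 := sum_permSum_smul c ha e
  rw [← hndef] at h1
  have h2 : ∀ σ, ∑ i, ∑ j, swapDrop a c σ i j ^ 2
      = 4 * A * C + (2 * n * Q σ + 4 * permSum a c σ ^ 2) := by
    intro σ
    rw [sum_sum_swapDrop_sq ha hc, hQ, permSum_sub_const]
    field_simp
    ring
  have hQ0 : ∑ k, (a k ^ 2 - A / n) = 0 := by
    simp only [Finset.sum_sub_distrib, Finset.sum_const, Finset.card_univ, nsmul_eq_mul]
    rw [← hndef, mul_div_cancel₀ _ hn.ne', sub_self]
  have hQM : ∑ σ, |Q σ| ≤ N * (√n * M' / 2) :=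
    sum_abs_permSum_le hQ0 (fun i j k l ↦ by simpa using hM' i j k l)
  have hSM : ∑ σ, permSum a c σ ^ 2 ≤ N * (n * M ^ 2 / 4) := sum_permSum_sq_le ha hM
  have key : (4 * n : ℂ) * ∑ σ, permSum a c σ * e σ
      - Complex.I * u * (4 * A * C : ℝ) * ∑ σ, e σ
      = ∑ σ, ∑ i, ∑ j, (swapDrop a c σ i j • (e σ - e (σ * Equiv.swap i j))
          - Complex.I * u * (swapDrop a c σ i j ^ 2 : ℝ) * e σ)
        + ∑ σ, Complex.I * u * (2 * n * Q σ + 4 * permSum a c σ ^ 2 : ℝ) * e σ := by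
    simp only [Finset.sum_sub_distrib]
    rw [← h1]
    have h3 : ∀ σ, ∑ i, ∑ j, Complex.I * u * (swapDrop a c σ i j ^ 2 : ℝ) * e σ
        = Complex.I * u * (4 * A * C : ℝ) * e σ
          + Complex.I * u * (2 * n * Q σ + 4 * permSum a c σ ^ 2 : ℝ) * e σ := by
      intro σ
      simp only [← Finset.sum_mul, ← Finset.mul_sum, ← Complex.ofReal_sum]
      rw [h2]
      push_cast
      ring
    simp only [h3, Finset.sum_add_distrib, Complex.real_smul, ← Finset.mul_sum]
    push_cast
    ring
  have hcast : ((Fintype.card ι : ℕ) : ℂ) = ((n : ℝ) : ℂ) := by simp [hndef]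
  rw [hcast, key]
  have hb1 : ‖∑ σ, ∑ i, ∑ j, (swapDrop a c σ i j • (e σ - e (σ * Equiv.swap i j))
          - Complex.I * u * (swapDrop a c σ i j ^ 2 : ℝ) * e σ)‖
      ≤ ∑ _σ : Equiv.Perm ι, ∑ _i : ι, ∑ _j : ι, 2 * u ^ 2 * M ^ 3 := by
    refine norm_sum_le_of_le _ fun σ _ ↦ norm_sum_le_of_le _ fun i _ ↦
      norm_sum_le_of_le _ fun j _ ↦ norm_swapDrop_smul_sub_le hM u σ i j
  have hb2 : ‖∑ σ, Complex.I * u * (2 * n * Q σ + 4 * permSum a c σ ^ 2 : ℝ) * e σ‖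
      ≤ ∑ σ, u * (2 * n * |Q σ| + 4 * permSum a c σ ^ 2) := by
    refine norm_sum_le_of_le _ fun σ _ ↦ ?_
    rw [norm_mul, hen, mul_one, norm_mul, norm_mul, Complex.norm_I, one_mul, Complex.norm_real,
      Complex.norm_real, Real.norm_of_nonneg hu, Real.norm_eq_abs]
    gcongr
    refine (abs_add_le _ _).trans ?_
    rw [abs_mul, abs_of_nonneg (by positivity : 0 ≤ 2 * n),
      abs_of_nonneg (by positivity : 0 ≤ 4 * permSum a c σ ^ 2)]
  simp only [Finset.sum_const, Finset.card_univ, nsmul_eq_mul, ← Finset.mul_sum,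
    Finset.sum_add_distrib] at hb1 hb2
  refine (norm_add_le _ _).trans ((add_le_add hb1 hb2).trans ?_)
  rw [← hndef, ← hNdef]
  have : u * (2 * n * ∑ σ, |Q σ| + 4 * ∑ σ, permSum a c σ ^ 2)
      ≤ u * (2 * n * (N * (√n * M' / 2)) + 4 * (N * (n * M ^ 2 / 4))) := by gcongr
  refine (add_le_add_right this _).trans_eq ?_
  ring

/-- Quantitative combinatorial central limit theorem: up to an error of order `1 / √n`, the
characteristic function at `1` of `permSum / √n` is that of a centred Gaussian of variance
`(∑ a²) (∑ c²) / n²`. -/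
theorem norm_mean_cexp_permSum_sub_le (ha : ∑ k, a k = 0) (hc : ∑ k, c k = 0)
    (hM : ∀ i j k l, |(a i - a j) * (c k - c l)| ≤ M)
    (hM' : ∀ i j k l, |(a i ^ 2 - a j ^ 2) * (c k ^ 2 - c l ^ 2)| ≤ M') :
    ‖(Fintype.card (Equiv.Perm ι) : ℂ)⁻¹ *
        ∑ σ, Complex.exp (Complex.I * (permSum a c σ / √(Fintype.card ι) : ℝ))
      - Complex.exp (-((∑ k, a k ^ 2) * (∑ k, c k ^ 2) / Fintype.card ι ^ 2 / 2 : ℝ))‖ ≤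
    (M' + M ^ 2 + 2 * M ^ 3) / (4 * √(Fintype.card ι)) := by
  have hn1 : (1 : ℝ) ≤ Fintype.card ι := by exact_mod_cast Fintype.card_pos
  have hNc : (Fintype.card (Equiv.Perm ι) : ℂ) = ((Fintype.card (Equiv.Perm ι) : ℝ) : ℂ) := by simp
  have hN : (0 : ℝ) < Fintype.card (Equiv.Perm ι) := by exact_mod_cast Fintype.card_pos
  have i0 := Classical.arbitrary ι
  have hM0 : 0 ≤ M := (abs_nonneg _).trans (hM i0 i0 i0 i0)
  have hM'0 : 0 ≤ M' := (abs_nonneg _).trans (hM' i0 i0 i0 i0)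
  have hmain := fun u (hu : 0 ≤ u) ↦ norm_sum_permSum_mul_cexp_sub_le ha hc hM hM' (u := u) hu
  have hcast : ((Fintype.card ι : ℕ) : ℂ) = (((Fintype.card ι : ℕ) : ℝ) : ℂ) := by simp
  rw [hcast] at hmain
  rw [hNc]
  set n : ℝ := ((Fintype.card ι : ℕ) : ℝ) with hndef
  set N : ℝ := ((Fintype.card (Equiv.Perm ι) : ℕ) : ℝ) with hNdef
  set A := ∑ k, a k ^ 2 with hA
  set C := ∑ k, c k ^ 2 with hC
  have hA0 : 0 ≤ A := Finset.sum_nonneg fun _ _ ↦ sq_nonneg _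
  have hC0 : 0 ≤ C := Finset.sum_nonneg fun _ _ ↦ sq_nonneg _
  have hn : 0 < n := by linarith
  have hs : 0 < √n := Real.sqrt_pos.2 hn
  have hs1 : 1 ≤ √n := Real.one_le_sqrt.2 hn1
  have hss : √n * √n = n := Real.mul_self_sqrt hn.le
  have hssc : (√n : ℂ) * √n = n := by exact_mod_cast hss
  have hsc : (√n : ℂ) ≠ 0 := by exact_mod_cast hs.ne'
  have hNc0 : (N : ℂ) ≠ 0 := by exact_mod_cast hN.ne'
  set v : ℝ := A * C / n ^ 2 with hv
  have hv0 : 0 ≤ v := by positivity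
  set R := (M' + M ^ 2 + 2 * M ^ 3) / (4 * √n) with hR
  -- the characteristic function at `t` is `T t / N`, its derivative is `(I / √n) * T' t / N`
  set T : ℝ → ℂ := fun t ↦ ∑ σ, Complex.exp (Complex.I * (t / √n * permSum a c σ : ℝ)) with hT
  set T' : ℝ → ℂ := fun t ↦
    ∑ σ, permSum a c σ * Complex.exp (Complex.I * (t / √n * permSum a c σ : ℝ)) with hT'
  have hTd : ∀ t, HasDerivAt T (Complex.I / √n * T' t) t := by
    intro t
    rw [hT', Finset.mul_sum]
    refine HasDerivAt.fun_sum fun σ _ ↦ ?_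
    have h1 : HasDerivAt (fun t : ℝ ↦ t / √n * permSum a c σ) (1 / √n * permSum a c σ) t :=
      ((hasDerivAt_id t).div_const _).mul_const _
    have h2 := (h1.ofReal_comp.const_mul Complex.I).cexp
    refine h2.congr_deriv ?_
    push_cast
    ring
  -- the characteristic function almost satisfies `φ' = -v t φ`
  have hbound : ∀ t ∈ Set.Ico (0 : ℝ) 1, ‖Complex.I / √n * T' t + v * t * T t‖ ≤ N * R := by
    intro t ht
    have hu0 : 0 ≤ t / √n := div_nonneg ht.1 hs.le
    have hu1 : t / √n ≤ 1 / √n := by gcongr; exact ht.2.le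
    have hu2 : t / √n ≤ 1 := hu1.trans (by rw [div_le_one hs]; exact hs1)
    have h := hmain (t / √n) hu0
    have e : Complex.I / √n * T' t + v * t * T t
        = Complex.I / (4 * n * √n) * ((4 * n : ℂ) * T' t -
          Complex.I * (t / √n : ℝ) * (4 * A * C : ℝ) * T t) := by
      rw [hv]
      push_cast
      rw [← hssc]
      field_simp
      ring_nf
      simp only [Complex.I_sq]
      ring
    have hpos : ‖Complex.I / (4 * n * √n : ℂ)‖ = 1 / (4 * n * √n) := by
      rw [norm_div, Complex.norm_I]
      congr 1
      rw [← Complex.norm_of_nonneg (by positivity : 0 ≤ 4 * n * √n)]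
      push_cast
      rfl
    rw [e, norm_mul, hpos]
    refine (mul_le_mul_of_nonneg_left h (by positivity)).trans ?_
    have h3 : t / √n * (n * √n * M' + n * M ^ 2) + 2 * (t / √n) ^ 2 * M ^ 3 * n ^ 2
        ≤ n * (M' + M ^ 2 + 2 * M ^ 3) := by
      have p1 : t / √n * (n * √n * M') ≤ 1 / √n * (n * √n * M') := by gcongr
      have p2 : t / √n * (n * M ^ 2) ≤ 1 * (n * M ^ 2) := by gcongr
      have p3 : 2 * (t / √n) ^ 2 * M ^ 3 * n ^ 2 ≤ 2 * (1 / √n) ^ 2 * M ^ 3 * n ^ 2 := by gcongr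
      have q1 : 1 / √n * (n * √n * M') = n * M' := by field_simp
      have q3 : 2 * (1 / √n) ^ 2 * M ^ 3 * n ^ 2 = n * (2 * M ^ 3) := by
        rw [div_pow, Real.sq_sqrt hn.le]; field_simp
      linarith
    calc _ ≤ 1 / (4 * n * √n) * (N * (n * (M' + M ^ 2 + 2 * M ^ 3))) := by gcongr
      _ = N * R := by rw [hR]; field_simp
  -- `exp (v t² / 2)` is the integrating factor of the limiting equation `φ' = -v t φ`
  set ψ : ℝ → ℂ := fun t ↦ Complex.exp (v * t ^ 2 / 2 : ℝ) * ((N : ℂ)⁻¹ * T t) with hψ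
  have hψd : ∀ t, HasDerivAt ψ (Complex.exp (v * t ^ 2 / 2 : ℝ) * ((N : ℂ)⁻¹ *
      (Complex.I / √n * T' t + v * t * T t))) t := by
    intro t
    have h1 : HasDerivAt (fun t : ℝ ↦ v * t ^ 2 / 2) (v * t) t := by
      have := ((hasDerivAt_pow 2 t).const_mul v).div_const 2
      refine this.congr_deriv ?_
      simp; ring
    have h2 := (h1.ofReal_comp.cexp).mul ((hTd t).const_mul (N : ℂ)⁻¹)
    refine h2.congr_deriv ?_
    push_cast
    ring
  have hdiff : ‖ψ 1 - ψ 0‖ ≤ Real.exp (v / 2) * R := by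
    refine norm_image_sub_le_of_norm_deriv_le_segment_01'
      (fun t _ ↦ (hψd t).hasDerivWithinAt) fun t ht ↦ ?_
    rw [norm_mul, norm_mul, Complex.norm_exp_ofReal, norm_inv, Complex.norm_real,
      Real.norm_of_nonneg hN.le]
    have h2 : t ^ 2 ≤ 1 := pow_le_one₀ ht.1 ht.2.le
    calc _ ≤ Real.exp (v * 1 / 2) * (N⁻¹ * (N * R)) := by gcongr; exact hbound t ht
      _ = _ := by rw [mul_one, inv_mul_cancel_left₀ hN.ne']
  have hT0 : T 0 = N := by simp [hT, hNdef]
  have hψ0 : ψ 0 = 1 := by simp only [hψ, hT0]; simp [hNc0]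
  have hfin : (N : ℂ)⁻¹ * ∑ σ, Complex.exp (Complex.I * (permSum a c σ / √n : ℝ))
      - Complex.exp (-(v / 2 : ℝ)) = Complex.exp (-(v / 2 : ℝ)) * (ψ 1 - ψ 0) := by
    have hT1 : T 1 = ∑ σ, Complex.exp (Complex.I * (permSum a c σ / √n : ℝ)) := by
      simp only [hT]
      refine Finset.sum_congr rfl fun σ _ ↦ ?_
      congr 3; ring
    rw [hψ0, mul_sub, mul_one, ← hT1]
    simp only [hψ]
    rw [← mul_assoc, ← Complex.exp_add]
    simp
  rw [hfin, norm_mul]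
  have : ‖Complex.exp (-(v / 2 : ℝ))‖ = Real.exp (-(v / 2)) := by
    rw [← Complex.ofReal_neg, Complex.norm_exp_ofReal]
  rw [this]
  calc _ ≤ Real.exp (-(v / 2)) * (Real.exp (v / 2) * R) := by gcongr
    _ = R := by rw [← mul_assoc, ← Real.exp_add]; simp

end CharFun

/-! ### Centred ranks and roots of unity -/

/-- The values `1/n, …, n/n`, centred to have mean zero. -/
noncomputable def centeredRank (n : ℕ) (j : Fin n) : ℝ := ((j : ℕ) + 1) / n - (n + 1) / (2 * n)

/-- The inner products of the `n`-th roots of unity `e^{2πik/n}`, `1 ≤ k ≤ n`, with `conj w`. -/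
noncomputable def rootCoeff (n : ℕ) (w : ℂ) (k : Fin n) : ℝ :=
  (w * Complex.exp (2 * Real.pi * Complex.I / n) ^ ((k : ℕ) + 1)).re

lemma sum_centeredRank {n : ℕ} (hn : n ≠ 0) : ∑ j, centeredRank n j = 0 := by
  have h : ∀ m : ℕ, ∑ j ∈ Finset.range m, ((j : ℝ) + 1) = m * (m + 1) / 2 := by
    intro m
    induction m with
    | zero => simp
    | succ m ih => rw [Finset.sum_range_succ, ih]; push_cast; ring
  have hn' : (n : ℝ) ≠ 0 := by exact_mod_cast hn
  simp only [centeredRank, Finset.sum_sub_distrib, ← Finset.sum_div]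
  rw [Fin.sum_univ_eq_sum_range (fun j ↦ (j : ℝ) + 1), h]
  simp
  field_simp
  ring

lemma sum_centeredRank_sq {n : ℕ} (hn : n ≠ 0) :
    ∑ j, centeredRank n j ^ 2 = ((n : ℝ) ^ 2 - 1) / (12 * n) := by
  have h : ∀ (m : ℕ) (x y : ℝ), ∑ j ∈ Finset.range m, (((j : ℝ) + 1) * x - y) ^ 2
      = m * (m + 1) * (2 * m + 1) / 6 * x ^ 2 - m * (m + 1) * x * y + m * y ^ 2 := by
    intro m x y
    induction m with
    | zero => simp
    | succ m ih => rw [Finset.sum_range_succ, ih]; push_cast; ring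
  have hn' : (n : ℝ) ≠ 0 := by exact_mod_cast hn
  simp only [centeredRank, div_eq_mul_inv]
  rw [Fin.sum_univ_eq_sum_range (fun j ↦ (((j : ℝ) + 1) * (n : ℝ)⁻¹
    - (n + 1) * (2 * (n : ℝ))⁻¹) ^ 2), h]
  field_simp
  ring

lemma abs_centeredRank_sub_le {n : ℕ} (i j : Fin n) :
    |centeredRank n i - centeredRank n j| ≤ 1 := by
  have hn : (0 : ℝ) < n := by exact_mod_cast i.pos
  have hi : ((i : ℕ) : ℝ) ≤ n := by exact_mod_cast i.2.le
  have hj : ((j : ℕ) : ℝ) ≤ n := by exact_mod_cast j.2.le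
  have : centeredRank n i - centeredRank n j = (((i : ℕ) : ℝ) - (j : ℕ)) / n := by
    simp only [centeredRank]; ring
  rw [this, abs_div, abs_of_pos hn, div_le_one hn, abs_le]
  have h0i : (0 : ℝ) ≤ ((i : ℕ) : ℝ) := by positivity
  have h0j : (0 : ℝ) ≤ ((j : ℕ) : ℝ) := by positivity
  constructor <;> linarith

lemma abs_centeredRank_le {n : ℕ} (i : Fin n) : |centeredRank n i| ≤ 1 := by
  have hn : (0 : ℝ) < n := by exact_mod_cast i.pos
  have hi : ((i : ℕ) : ℝ) + 1 ≤ n := by exact_mod_cast i.2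
  have h0i : (0 : ℝ) ≤ ((i : ℕ) : ℝ) := by positivity
  have : centeredRank n i = (2 * ((i : ℕ) + 1) - (n + 1)) / (2 * n) := by
    simp only [centeredRank]; field_simp
  rw [this, abs_div, abs_of_pos (by positivity : (0 : ℝ) < 2 * n), div_le_one (by positivity),
    abs_le]
  constructor <;> linarith

lemma sum_pow_succ_eq_zero {n : ℕ} {w : ℂ} (h1 : w ≠ 1) (hn : w ^ n = 1) :
    ∑ k : Fin n, w ^ ((k : ℕ) + 1) = 0 := by
  rw [Fin.sum_univ_eq_sum_range (fun k ↦ w ^ (k + 1))]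
  simp only [pow_succ, ← Finset.sum_mul]
  rw [geom_sum_eq h1, hn]
  simp

lemma norm_root_pow (n k : ℕ) :
    ‖Complex.exp (2 * Real.pi * Complex.I / n) ^ k‖ = 1 := by
  rw [norm_pow]
  have : (2 * Real.pi * Complex.I / n : ℂ) = (2 * Real.pi / n : ℝ) * Complex.I := by
    push_cast; ring
  rw [this, Complex.norm_exp_ofReal_mul_I, one_pow]

lemma sum_rootCoeff {n : ℕ} (hn : 2 ≤ n) (w : ℂ) : ∑ k, rootCoeff n w k = 0 := by
  have hp := Complex.isPrimitiveRoot_exp n (by omega)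
  simp only [rootCoeff, ← Complex.re_sum, ← Finset.mul_sum]
  rw [sum_pow_succ_eq_zero (hp.ne_one (by omega)) hp.pow_eq_one]
  simp

lemma sum_rootCoeff_sq {n : ℕ} (hn : 3 ≤ n) (w : ℂ) :
    ∑ k, rootCoeff n w k ^ 2 = n * ‖w‖ ^ 2 / 2 := by
  have hp := Complex.isPrimitiveRoot_exp n (by omega)
  have h : ∀ k : Fin n, rootCoeff n w k ^ 2 = ‖w‖ ^ 2 / 2 +
      (w ^ 2 / 2 * (Complex.exp (2 * Real.pi * Complex.I / n) ^ 2) ^ ((k : ℕ) + 1)).re := by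
    intro k
    have e : ∀ y : ℂ, y.re ^ 2 = ‖y‖ ^ 2 / 2 + (y ^ 2 / 2).re := by
      intro y
      rw [Complex.sq_norm, Complex.normSq_apply, pow_two y, Complex.div_ofNat_re, Complex.mul_re]
      ring
    rw [rootCoeff, e, norm_mul, norm_root_pow, mul_one]
    congr 2
    ring
  simp only [h, Finset.sum_add_distrib, ← Complex.re_sum, ← Finset.mul_sum]
  rw [sum_pow_succ_eq_zero (hp.pow_ne_one_of_pos_of_lt (by norm_num) (by omega))
    (by rw [pow_right_comm, hp.pow_eq_one, one_pow])]
  simp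
  ring

lemma abs_rootCoeff_le (n : ℕ) (w : ℂ) (k : Fin n) : |rootCoeff n w k| ≤ ‖w‖ := by
  refine (Complex.abs_re_le_norm _).trans ?_
  rw [norm_mul, norm_root_pow, mul_one]

/-- Centring the values of `σ` does not change the centroid, as the roots of unity sum to `0`. -/
lemma re_mul_permCentroid {n : ℕ} (hn : 2 ≤ n) (w : ℂ) (σ : Equiv.Perm (Fin n)) :
    (w * permCentroid n σ).re = permSum (centeredRank n) (rootCoeff n w) σ := by
  rw [show centeredRank n = fun j : Fin n ↦ (((j : ℕ) + 1) / n - (n + 1) / (2 * n) : ℝ) from rfl,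
    permSum_sub_const, sum_rootCoeff hn, mul_zero, sub_zero, permCentroid, permSum,
    Finset.mul_sum, Finset.mul_sum, Complex.re_sum]
  refine Finset.sum_congr rfl fun k _ ↦ ?_
  rw [rootCoeff, ← Complex.re_ofReal_mul, ← Complex.exp_nat_mul]
  congr 1
  have : (2 * Real.pi * Complex.I * (((k : ℕ) : ℂ) + 1) / n : ℂ)
      = (((k : ℕ) + 1 : ℕ) : ℂ) * (2 * Real.pi * Complex.I / n) := by push_cast; ring
  rw [this]
  push_cast
  ring

/-- Convergence of the characteristic functions: the argument of the characteristic function of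
`C_n / √n` is encoded by `w` through `z ↦ Re (w z)`. The abstract bound applies with variance
`‖w‖² / 24 * (1 - 1 / n²)` once `n ≥ 3`, when the squares of the roots of unity also sum to `0`. -/
theorem tendsto_mean_cexp_re_mul_permCentroid (w : ℂ) :
    Tendsto (fun n : ℕ ↦ ((n.factorial : ℕ) : ℂ)⁻¹ * ∑ σ : Equiv.Perm (Fin n),
        Complex.exp (Complex.I * ((w * permCentroid n σ).re / √n : ℝ))) atTop
      (𝓝 (Complex.exp (-(‖w‖ ^ 2 / 48 : ℝ)))) := by
  set K := ‖w‖
  set R : ℝ := 2 * K ^ 2 + (2 * K) ^ 2 + 2 * (2 * K) ^ 3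
  have hbound : ∀ n : ℕ, 3 ≤ n → ‖((n.factorial : ℕ) : ℂ)⁻¹ * ∑ σ : Equiv.Perm (Fin n),
        Complex.exp (Complex.I * ((w * permCentroid n σ).re / √n : ℝ))
        - Complex.exp (-(K ^ 2 / 48 * (1 - ((n : ℝ) ^ 2)⁻¹) : ℝ))‖ ≤ R / (4 * √n) := by
    intro n hn
    have : NeZero n := ⟨by omega⟩
    have hn' : (n : ℝ) ≠ 0 := by exact_mod_cast this.out
    have hc : ∀ k, |rootCoeff n w k| ≤ K := abs_rootCoeff_le n w
    have h := norm_mean_cexp_permSum_sub_le (a := centeredRank n) (c := rootCoeff n w)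
      (M := 2 * K) (M' := 2 * K ^ 2)
      (sum_centeredRank (by omega)) (sum_rootCoeff (by omega) w) (fun i j k l ↦ by
        rw [abs_mul]
        calc _ ≤ 1 * (K + K) := by
              gcongr
              · exact abs_centeredRank_sub_le i j
              · exact (abs_sub _ _).trans (add_le_add (hc k) (hc l))
          _ = _ := by ring) (fun i j k l ↦ by
        have hc2 : ∀ k, |rootCoeff n w k ^ 2| ≤ K ^ 2 := fun k ↦ by
          rw [abs_pow]; gcongr; exact hc k
        have ha2 : |centeredRank n i ^ 2 - centeredRank n j ^ 2| ≤ 1 := by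
          have := abs_le_one_iff_mul_self_le_one.1 (abs_centeredRank_le i)
          have := abs_le_one_iff_mul_self_le_one.1 (abs_centeredRank_le j)
          rw [abs_le]
          constructor <;> nlinarith [sq_nonneg (centeredRank n i), sq_nonneg (centeredRank n j)]
        rw [abs_mul]
        calc _ ≤ 1 * (K ^ 2 + K ^ 2) := by
              gcongr
              exact (abs_sub _ _).trans (add_le_add (hc2 k) (hc2 l))
          _ = _ := by ring)
    rw [sum_centeredRank_sq (by omega), sum_rootCoeff_sq hn, Fintype.card_perm,
      Fintype.card_fin] at h
    have hv : ((n : ℝ) ^ 2 - 1) / (12 * n) * (n * K ^ 2 / 2) / n ^ 2 / 2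
        = K ^ 2 / 48 * (1 - ((n : ℝ) ^ 2)⁻¹) := by
      field_simp
      ring
    rw [hv] at h
    simp only [re_mul_permCentroid (by omega : 2 ≤ n)]
    exact h
  have hlim1 : Tendsto (fun n : ℕ ↦ Complex.exp (-(K ^ 2 / 48 * (1 - ((n : ℝ) ^ 2)⁻¹) : ℝ)))
      atTop (𝓝 (Complex.exp (-(K ^ 2 / 48 : ℝ)))) := by
    have h1 : Tendsto (fun n : ℕ ↦ ((n : ℝ) ^ 2)⁻¹) atTop (𝓝 0) :=
      tendsto_inv_atTop_zero.comp
        ((tendsto_pow_atTop two_ne_zero).comp tendsto_natCast_atTop_atTop)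
    have h2 : Tendsto (fun n : ℕ ↦ K ^ 2 / 48 * (1 - ((n : ℝ) ^ 2)⁻¹)) atTop
        (𝓝 (K ^ 2 / 48 * (1 - 0))) := (h1.const_sub 1).const_mul _
    rw [sub_zero, mul_one] at h2
    exact (Complex.continuous_exp.tendsto _).comp
      (((Complex.continuous_ofReal.tendsto _).comp h2).neg)
  have hlim2 : Tendsto (fun n : ℕ ↦ R / (4 * √n)) atTop (𝓝 0) := by
    refine Tendsto.div_atTop tendsto_const_nhds ?_
    exact Tendsto.const_mul_atTop (by norm_num)
      (Real.tendsto_sqrt_atTop.comp tendsto_natCast_atTop_atTop)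
  have hdiff := squeeze_zero_norm' (eventually_atTop.2 ⟨3, hbound⟩) hlim2
  simpa using hdiff.add hlim1

/-! ### Uniform permutations and the Gaussian limit -/

lemma measurable_comp_of_isUniformPerm {Ω E : Type*} [MeasurableSpace Ω] [MeasurableSpace E]
    {P : Measure Ω} {n : ℕ} {σ : Ω → Equiv.Perm (Fin n)} (hσ : IsUniformPerm P n σ)
    (f : Equiv.Perm (Fin n) → E) : Measurable fun ω ↦ f (σ ω) := by
  let _ : MeasurableSpace (Equiv.Perm (Fin n)) := ⊤
  have h : Measurable σ := measurable_to_countable' fun τ ↦ (hσ τ).1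
  exact (measurable_from_top (f := f)).comp h

lemma integral_comp_of_isUniformPerm {Ω : Type*} [MeasurableSpace Ω]
    {P : Measure Ω} [IsProbabilityMeasure P] {n : ℕ} {σ : Ω → Equiv.Perm (Fin n)}
    (hσ : IsUniformPerm P n σ) (f : Equiv.Perm (Fin n) → ℂ) :
    ∫ ω, f (σ ω) ∂P = ((n.factorial : ℕ) : ℂ)⁻¹ * ∑ τ, f τ := by
  let _ : MeasurableSpace (Equiv.Perm (Fin n)) := ⊤
  have _ : DiscreteMeasurableSpace (Equiv.Perm (Fin n)) := ⟨fun _ ↦ trivial⟩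
  have h : Measurable σ := measurable_to_countable' fun τ ↦ (hσ τ).1
  have _ := Measure.isProbabilityMeasure_map (μ := P) h.aemeasurable
  rw [← integral_map (φ := σ) (f := f) h.aemeasurable
    (measurable_of_finite f).aestronglyMeasurable,
    integral_fintype Integrable.of_finite, Finset.mul_sum]
  refine Finset.sum_congr rfl fun τ _ ↦ ?_
  rw [Measure.real, Measure.map_apply h (measurableSet_singleton τ), (hσ τ).2]
  simp

/-- The limiting law in the plane: independent centred coordinates of variance `1 / 24`. -/
noncomputable abbrev limitGaussian : Measure (EuclideanSpace ℝ (Fin 2)) :=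
  multivariateGaussian (0 : EuclideanSpace ℝ (Fin 2))
    (!![1 / 24, 0; 0, 1 / 24] : Matrix (Fin 2) (Fin 2) ℝ)

lemma posSemidef_diag : (!![1 / 24, 0; 0, 1 / 24] : Matrix (Fin 2) (Fin 2) ℝ).PosSemidef := by
  have : (!![1 / 24, 0; 0, 1 / 24] : Matrix (Fin 2) (Fin 2) ℝ)
      = Matrix.diagonal fun _ ↦ 1 / 24 := by
    ext i j; fin_cases i <;> fin_cases j <;> simp
  rw [this]
  exact Matrix.PosSemidef.diagonal fun _ ↦ by norm_num

lemma charFun_limit (t : EuclideanSpace ℝ (Fin 2)) :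
    charFun limitGaussian t = Complex.exp (-(‖t‖ ^ 2 / 48 : ℝ)) := by
  rw [charFun_multivariateGaussian posSemidef_diag, EuclideanSpace.real_norm_sq_eq]
  congr 1
  simp [Matrix.mulVec, dotProduct, Fin.sum_univ_two]
  ring

/-- The identification `(x, y) ↦ x + i y` of the Euclidean plane with `ℂ`. -/
noncomputable def planeToComplex : EuclideanSpace ℝ (Fin 2) ≃ₗᵢ[ℝ] ℂ :=
  Complex.orthonormalBasisOneI.repr.symm

lemma planeToComplex_apply (x : EuclideanSpace ℝ (Fin 2)) :
    planeToComplex x = x 0 + x 1 * Complex.I := by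
  simp [planeToComplex, ← Complex.orthonormalBasisOneI.sum_repr_symm, Fin.sum_univ_two]

lemma tendstoInDistribution_plane {Ω : ℕ → Type*} [∀ n, MeasurableSpace (Ω n)]
    (P : (n : ℕ) → Measure (Ω n)) [∀ n, IsProbabilityMeasure (P n)]
    (σ : (n : ℕ) → Ω n → Equiv.Perm (Fin n))
    (hσ : ∀ n, IsUniformPerm (P n) n (σ n)) :
    TendstoInDistribution
      (fun (n : ℕ) (ω : Ω n) =>
        (!₂[(1 / √(n : ℝ)) * (permCentroid n (σ n ω)).re,
            (1 / √(n : ℝ)) * (permCentroid n (σ n ω)).im] : EuclideanSpace ℝ (Fin 2)))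
      atTop id P limitGaussian := by
  have hm : ∀ n, Measurable (fun (ω : Ω n) =>
        (!₂[(1 / √(n : ℝ)) * (permCentroid n (σ n ω)).re,
            (1 / √(n : ℝ)) * (permCentroid n (σ n ω)).im] : EuclideanSpace ℝ (Fin 2))) := fun n ↦
    measurable_comp_of_isUniformPerm (hσ n) (fun τ ↦
        (!₂[(1 / √(n : ℝ)) * (permCentroid n τ).re,
            (1 / √(n : ℝ)) * (permCentroid n τ).im] : EuclideanSpace ℝ (Fin 2)))
  refine ⟨fun n ↦ (hm n).aemeasurable, by fun_prop, ?_⟩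
  refine ProbabilityMeasure.tendsto_iff_tendsto_charFun.2 fun t ↦ ?_
  simp only [ProbabilityMeasure.coe_mk, Measure.map_id, charFun_limit]
  have h := tendsto_mean_cexp_re_mul_permCentroid (conj (planeToComplex t))
  rw [RCLike.norm_conj, LinearIsometryEquiv.norm_map] at h
  refine h.congr fun n ↦ ?_
  rw [charFun_apply, integral_map (hm n).aemeasurable (by fun_prop),
    ← integral_comp_of_isUniformPerm (hσ n) (fun τ ↦ Complex.exp
      (Complex.I * (((conj (planeToComplex t)) * permCentroid n τ).re / √n : ℝ)))]
  refine integral_congr_ae (Eventually.of_forall fun ω ↦ ?_)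
  simp only [planeToComplex_apply]
  rw [mul_comm Complex.I]
  congr 3
  simp [PiLp.inner_apply, Fin.sum_univ_two]
  ring

/-- The limiting law in the complex plane. -/
noncomputable def limitComplexGaussian : ProbabilityMeasure ℂ :=
  ⟨limitGaussian.map planeToComplex, Measure.isProbabilityMeasure_map (by fun_prop)⟩

lemma charFun_map_planeToComplex (z : ℂ) :
    charFun (limitGaussian.map planeToComplex) z = Complex.exp (-(‖z‖ ^ 2 / 48 : ℝ)) := by
  rw [← planeToComplex.symm.norm_map z, ← charFun_limit, charFun_apply, charFun_apply,
    integral_map (by fun_prop) (by fun_prop)]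
  congr! 4 with x
  rw [← planeToComplex.inner_map_map]
  simp

lemma isCircularComplexNormal_map_planeToComplex :
    IsCircularComplexNormal (limitGaussian.map planeToComplex) (1 / 12) where
  isGaussian := isGaussian_map_equiv planeToComplex.toContinuousLinearEquiv
  mean_eq_zero := by
    rw [integral_map (by fun_prop) (by fun_prop)]
    have h := planeToComplex.toContinuousLinearEquiv.toContinuousLinearMap.integral_comp_comm
      (IsGaussian.integrable_fun_id (μ := limitGaussian))
    rw [integral_id_multivariateGaussian] at h
    simpa using h
  map_rotation θ := by
    have _ : IsProbabilityMeasure (limitGaussian.map planeToComplex) :=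
      Measure.isProbabilityMeasure_map (by fun_prop)
    refine Measure.ext_of_charFun ?_
    ext z
    rw [charFun_map_planeToComplex, charFun_apply, integral_map (by fun_prop) (by fun_prop)]
    have h := charFun_map_planeToComplex (conj (Complex.exp (θ * Complex.I)) * z)
    rw [norm_mul, RCLike.norm_conj, Complex.norm_exp_ofReal_mul_I, one_mul] at h
    rw [← h, charFun_apply]
    congr! 4 with x
    simp only [Complex.inner, map_mul]
    ring_nf
  variance_eq := by
    rw [integral_map (by fun_prop) (by fun_prop)]
    simp only [LinearIsometryEquiv.norm_map, EuclideanSpace.real_norm_sq_eq, Fin.sum_univ_two]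
    have hL : ∀ i : Fin 2, MemLp (fun x : EuclideanSpace ℝ (Fin 2) ↦ x i) 2
        limitGaussian := fun i ↦
      (EuclideanSpace.proj (𝕜 := ℝ) i).comp_memLp' IsGaussian.memLp_two_id
    have h0 : ∀ i : Fin 2, ∫ x : EuclideanSpace ℝ (Fin 2), x i ∂limitGaussian = 0 := by
      intro i
      have h := (EuclideanSpace.proj (𝕜 := ℝ) i).integral_comp_comm
        (IsGaussian.integrable_fun_id (μ := limitGaussian))
      rw [integral_id_multivariateGaussian] at h
      simpa using h
    have hv : ∀ i : Fin 2, ∫ x : EuclideanSpace ℝ (Fin 2), x i ^ 2 ∂limitGaussian = 1 / 24 := by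
      intro i
      rw [← variance_of_integral_eq_zero (hL i).aemeasurable (h0 i),
        variance_eval_multivariateGaussian posSemidef_diag]
      fin_cases i <;> simp
    rw [integral_add (hL 0).integrable_sq (hL 1).integrable_sq, hv, hv]
    norm_num

theorem theorem1 {Ω : ℕ → Type*} [∀ n, MeasurableSpace (Ω n)]
    (P : (n : ℕ) → Measure (Ω n)) [∀ n, IsProbabilityMeasure (P n)]
    (σ : (n : ℕ) → Ω n → Equiv.Perm (Fin n))
    (hσ : ∀ n, IsUniformPerm (P n) n (σ n)) :
    TendstoInDistribution
      (fun (n : ℕ) (ω : Ω n) =>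
        (!₂[(1 / √(n : ℝ)) * (permCentroid n (σ n ω)).re,
            (1 / √(n : ℝ)) * (permCentroid n (σ n ω)).im] : EuclideanSpace ℝ (Fin 2)))
      atTop id P
      (multivariateGaussian (0 : EuclideanSpace ℝ (Fin 2))
        (!![1 / 24, 0; 0, 1 / 24] : Matrix (Fin 2) (Fin 2) ℝ)) ∧
    ∃ ν : ProbabilityMeasure ℂ, IsCircularComplexNormal (ν : Measure ℂ) (1 / 12) ∧
      TendstoInDistribution
        (fun (n : ℕ) (ω : Ω n) => (1 / ((√(n : ℝ) : ℝ) : ℂ)) * permCentroid n (σ n ω))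
        atTop id P (ν : Measure ℂ) := by
  have h := tendstoInDistribution_plane P σ hσ
  refine ⟨h, limitComplexGaussian, isCircularComplexNormal_map_planeToComplex, ?_⟩
  have h2 := h.continuous_comp planeToComplex.continuous
  have hX : ∀ (n : ℕ) (ω : Ω n), (1 / ((√(n : ℝ) : ℝ) : ℂ)) * permCentroid n (σ n ω)
      = planeToComplex (!₂[(1 / √(n : ℝ)) * (permCentroid n (σ n ω)).re,
            (1 / √(n : ℝ)) * (permCentroid n (σ n ω)).im]) := by
    intro n ω
    rw [planeToComplex_apply]
    conv_lhs => rw [← Complex.re_add_im (permCentroid n (σ n ω))]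
    simp only [Matrix.cons_val_zero, Matrix.cons_val_one]
    push_cast
    ring
  simp only [hX]
  have hlim : (limitComplexGaussian : Measure ℂ).map id =
      limitGaussian.map (planeToComplex ∘ id) := by
    rw [Measure.map_id, Function.comp_id]
    rfl
  refine ⟨h2.forall_aemeasurable, aemeasurable_id, ?_⟩
  simp only [hlim]
  exact h2.tendsto
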